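/- For a graph $G$ and a graph $F$, let $c(G,F)$ denote the minimum number $k$ of colors for which the edges of $G$ can be colored with $k$ colors so that there is no monochromatic copy of $F$ (as a not necessarily induced subgraph). Let $P_{n+1}$ be the path on $n+1$ vertices, and let $G(N,p)$ be the binomial random graph on $N$ vertices with edge probability $p$. Let $N=N(n)$ be integers with $N>n$, let $p=p(n)\in[0,1]$, and put $r=N/n$. Suppose that $pN^2\to\infty$ as $n\to\infty$ (for instance, $p\ge 1/N$) and that, for all sufficiently large $n$, $$p\le \frac{\log r}{34\,n},$$ where $\log$ is the natural logarithm. Then, with probability tending to $1$ as $n\to\infty$, $$c\bigl(G(N,p),P_{n+1}\bigr)\ \ge\ \frac{\log\omega}{24\,\omega}\,r,\qquad\text{where } \omega=\frac{\log r}{np}.$$ -/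

import Mathlib

open Filter Topology
open scoped unitInterval

/-- `c(G, F)`: the minimum number `k` of colours such that the edges of `G` can be coloured
with `k` colours without a monochromatic copy of `F` (every colour class is `F`-free; edge
colourings need not be proper). The set of such `k` is nonempty whenever `G` is finite and `F` has
at least two edges. -/
noncomputable def SimpleGraph.minColors {V W : Type*} (G : SimpleGraph V) (F : SimpleGraph W) : ℕ :=
  sInf {k : ℕ | ∃ C : G.EdgeLabeling (Fin k), ∀ i : Fin k, F.Free (C.labelGraph i)}

/-!
Finish the vertices of a graph without a path on `n + 1` vertices in depth-first order. The stack
of the search is a path, so for every initial segment of this order at most `n` vertices receive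
all edges leaving the segment. Cutting the order into about `r = N / n` blocks of `n` vertices, such
a graph is contained in one of at most `exp (2.3 N log r)` graphs with at most `2 n N` edges. By
Chernoff's bound `G(N, p)` meets each of these in fewer than `M = 5.5 N log r / log ω` edges,
except with probability `exp (-2.35 N log r)`. Hence with high probability every colour class has
at most `M` edges, while `G(N, p)` has at least half of its expected `p N (N - 1) / 2` edges.
-/

section Colouring

open SimpleGraph

variable {V W : Type*}

lemma exists_edgeLabeling_free_of_nontrivial [Finite V] (G : SimpleGraph V) {F : SimpleGraph W}
    (hF : F.edgeSet.Nontrivial) :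
    ∃ (k : ℕ) (C : G.EdgeLabeling (Fin k)), ∀ i, F.Free (C.labelGraph i) := by
  obtain ⟨k, ⟨φ⟩⟩ := Finite.exists_equiv_fin G.edgeSet
  let C : G.EdgeLabeling (Fin k) := fun e => φ e
  have subsingleton_edgeSet (i : Fin k) : (C.labelGraph i).edgeSet.Subsingleton := by
    rintro ⟨u, v⟩ he ⟨u', v'⟩ he'
    obtain ⟨h, hi⟩ := (EdgeLabeling.labelGraph_adj u v).1 he
    obtain ⟨h', hi'⟩ := (EdgeLabeling.labelGraph_adj u' v').1 he'
    exact congrArg Subtype.val (φ.injective (hi.trans hi'.symm))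
  refine ⟨k, C, fun i ⟨c⟩ => ?_⟩
  obtain ⟨e, he, e', he', hne⟩ := hF
  have heq : c.mapEdgeSet ⟨e, he⟩ = c.mapEdgeSet ⟨e', he'⟩ :=
    Subtype.ext (subsingleton_edgeSet i (Subtype.prop _) (Subtype.prop _))
  exact hne (congrArg Subtype.val (c.mapEdgeSet.injective heq))

lemma ncard_edgeSet_le_minColors_mul [Finite V] {G : SimpleGraph V} {F : SimpleGraph W}
    (hF : F.edgeSet.Nontrivial) {M : ℝ} (hM : ∀ H ≤ G, F.Free H → (H.edgeSet.ncard : ℝ) ≤ M) :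
    (G.edgeSet.ncard : ℝ) ≤ G.minColors F * M := by
  obtain ⟨C, hC⟩ : ∃ C : G.EdgeLabeling (Fin (G.minColors F)), ∀ i, F.Free (C.labelGraph i) :=
    Nat.sInf_mem (exists_edgeLabeling_free_of_nontrivial G hF)
  have edgeSet_subset : G.edgeSet ⊆ ⋃ i, (C.labelGraph i).edgeSet := by
    rintro ⟨u, v⟩ he
    exact Set.mem_iUnion.2 ⟨C ⟨s(u, v), he⟩, (EdgeLabeling.labelGraph_adj u v).2 ⟨he, rfl⟩⟩
  calc (G.edgeSet.ncard : ℝ) ≤ ∑ i, ((C.labelGraph i).edgeSet.ncard : ℝ) := by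
        exact_mod_cast (Set.ncard_le_ncard edgeSet_subset (Set.toFinite _)).trans
          (Set.ncard_iUnion_le_of_fintype _)
    _ ≤ ∑ _i : Fin (G.minColors F), M := Finset.sum_le_sum fun i _ => hM _ C.labelGraph_le (hC i)
    _ = G.minColors F * M := by simp

lemma edgeSet_eq_empty_of_minColors_eq_zero [Finite V] {G : SimpleGraph V} {F : SimpleGraph W}
    (hF : F.edgeSet.Nontrivial) (h : G.minColors F = 0) : G.edgeSet = ∅ := by
  have hcard := ncard_edgeSet_le_minColors_mul (G := G) hF (M := G.edgeSet.ncard) fun H hH _ => by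
    exact_mod_cast Set.ncard_le_ncard (edgeSet_mono hH) (Set.toFinite _)
  rw [h, Nat.cast_zero, zero_mul] at hcard
  exact (Set.ncard_eq_zero (Set.toFinite _)).1 (by exact_mod_cast hcard.antisymm (by positivity))

lemma nontrivial_edgeSet_pathGraph {n : ℕ} (hn : 2 ≤ n) :
    (pathGraph (n + 1)).edgeSet.Nontrivial := by
  refine ⟨s(⟨0, by omega⟩, ⟨1, by omega⟩), ?_, s(⟨1, by omega⟩, ⟨2, by omega⟩), ?_, ?_⟩
  · exact pathGraph_adj.2 (.inl rfl)
  · exact pathGraph_adj.2 (.inl rfl)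
  · simp

end Colouring

section DepthFirstSearch

open SimpleGraph
open scoped Finset

variable {V : Type*} {H : SimpleGraph V} {n : ℕ}

lemma length_le_of_pathGraph_free (hH : (pathGraph (n + 1)).Free H) {l : List V}
    (hl : l.IsChain H.Adj) (hd : l.Nodup) : l.length ≤ n := by
  by_contra! hlen
  rw [List.isChain_iff_getElem] at hl
  refine hH ⟨⟨⟨fun i => l[i.val]'(by omega), fun {i j} hij => ?_⟩, fun i j hij => ?_⟩⟩
  · rcases pathGraph_adj.1 hij with h | h
    · simpa [h] using hl i.val (by omega)
    · simpa [h] using (hl j.val (by omega)).symm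
  · exact Fin.ext (hd.getElem_inj_iff.1 hij)

/-- The reachable states of a depth-first search of `H`: `IsDFSState H L P` says that some search
has finished the vertices in `L`, in this order, and has the stack `P`, whose top is its head. -/
inductive IsDFSState (H : SimpleGraph V) : List V → List V → Prop
  | start : IsDFSState H [] []
  | push {L P : List V} {v : V} :
      IsDFSState H L P → v ∉ P ++ L → (v :: P).IsChain H.Adj → IsDFSState H L (v :: P)
  | pop {L P : List V} {a : V} :
      IsDFSState H L (a :: P) → (∀ v, H.Adj a v → v ∈ a :: P ++ L) → IsDFSState H (L ++ [a]) P

namespace IsDFSState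

variable {L P : List V}

lemma isChain (h : IsDFSState H L P) : P.IsChain H.Adj := by
  induction h with
  | start => exact .nil
  | push _ _ hchain => exact hchain
  | pop _ _ ih => exact ih.tail

lemma nodup (h : IsDFSState H L P) : (P ++ L).Nodup := by
  induction h with
  | start => exact List.nodup_nil
  | push _ hv _ ih => exact List.nodup_cons.2 ⟨hv, ih⟩
  | @pop L P a _ _ ih =>
    rw [← List.append_assoc]
    exact (List.perm_append_singleton a (P ++ L)).nodup_iff.2 ih

lemma mem_of_adj (h : IsDFSState H L P) {u v : V} (hu : u ∈ L) (huv : H.Adj u v) :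
    v ∈ P ++ L := by
  induction h with
  | start => cases hu
  | push _ _ _ ih => exact List.mem_cons_of_mem _ (ih hu)
  | @pop L P a _ ha ih =>
    rw [← List.append_assoc, (List.perm_append_singleton a (P ++ L)).mem_iff]
    rcases List.mem_append.1 hu with hu | hu
    · exact ih hu
    · exact ha v (List.mem_singleton.1 hu ▸ huv)

lemma exists_take (h : IsDFSState H L P) (m : ℕ) : ∃ P', IsDFSState H (L.take m) P' := by
  induction h with
  | start => exact ⟨[], by simpa only [List.take_nil] using start⟩
  | push _ _ _ ih => exact ih
  | @pop L P a h ha ih =>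
    rcases le_or_gt m L.length with hm | hm
    · rwa [List.take_append_of_le_length hm]
    · rw [List.take_of_length_le (by simpa using hm)]
      exact ⟨P, h.pop ha⟩

lemma exists_next (h : IsDFSState H L P) (hL : ∃ v, v ∉ L) :
    ∃ L' P', IsDFSState H L' P' ∧ 2 * L'.length + P'.length = 2 * L.length + P.length + 1 := by
  cases P with
  | nil =>
    obtain ⟨v, hv⟩ := hL
    exact ⟨L, [v], h.push hv (List.isChain_singleton v), rfl⟩
  | cons a P =>
    by_cases hfresh : ∃ v, v ∉ a :: P ++ L ∧ H.Adj a v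
    · obtain ⟨v, hv, hav⟩ := hfresh
      exact ⟨L, v :: a :: P, h.push hv (.cons_cons hav.symm h.isChain), rfl⟩
    · push Not at hfresh
      refine ⟨L ++ [a], P, h.pop fun v hav => ?_, ?_⟩
      · exact by_contra fun hv => hfresh v hv hav
      · simp only [List.length_append, List.length_cons, List.length_nil]
        omega

end IsDFSState

lemma exists_isDFSState_forall_mem [Finite V] (H : SimpleGraph V) :
    ∃ L P, IsDFSState H L P ∧ ∀ v, v ∈ L := by
  have := Fintype.ofFinite V
  by_contra! hincomplete
  have unbounded (k : ℕ) : ∃ L P, IsDFSState H L P ∧ 2 * L.length + P.length = k := by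
    induction k with
    | zero => exact ⟨[], [], .start, rfl⟩
    | succ k ih =>
      obtain ⟨L, P, h, rfl⟩ := ih
      exact h.exists_next (hincomplete L P h)
  obtain ⟨L, P, h, hlen⟩ := unbounded (2 * Fintype.card V + 1)
  have hcard := h.nodup.length_le_card
  rw [List.length_append] at hcard
  omega

/-- The vertices are ranked in the order in which a depth-first search finishes them. Every edge
between the first `m` of them and the rest ends on the stack which the search has after finishing
those `m` vertices, and that stack is a path. -/
lemma exists_rank_of_pathGraph_free [Fintype V] (hH : (pathGraph (n + 1)).Free H) :
    ∃ rank : V → ℕ, rank.Injective ∧ (∀ v, rank v < Fintype.card V) ∧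
      ∀ m, ∃ S : Finset V, #S ≤ n ∧ ∀ u v, H.Adj u v → rank u < m → m ≤ rank v → v ∈ S := by
  classical
  obtain ⟨L, P, hLP, hmem⟩ := exists_isDFSState_forall_mem H
  have mem_take (v : V) (m : ℕ) : v ∈ L.take m ↔ L.idxOf v < m :=
    List.mem_take_iff_idxOf_lt (hmem v)
  refine ⟨(L.idxOf ·), fun u v h => (List.idxOf_inj (hmem u)).1 h, fun v => ?_, fun m => ?_⟩
  · exact (List.idxOf_lt_length_iff.2 (hmem v)).trans_le hLP.nodup.of_append_right.length_le_card
  · obtain ⟨stack, hstack⟩ := hLP.exists_take m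
    refine ⟨stack.toFinset, ?_, fun u v huv hu hv => ?_⟩
    · exact (List.toFinset_card_le _).trans
        (length_le_of_pathGraph_free hH hstack.isChain hstack.nodup.of_append_left)
    · have hmem_or := List.mem_append.1 (hstack.mem_of_adj ((mem_take u m).2 hu) huv)
      exact List.mem_toFinset.2 (hmem_or.resolve_right fun h => hv.not_gt ((mem_take v m).1 h))

end DepthFirstSearch

section Containers

open SimpleGraph
open scoped Finset

variable {V ι : Type*} [Fintype V] {n : ℕ}

/-- The graph joining two vertices if they lie in the same block, where `f v` is the block of `v`,
or if one of them belongs to the set attached by `S` to the block of the other. With few blocks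
and small attached sets these graphs are the containers of the graphs without a long path. -/
def blockGraph (f : V → ι) (S : ι → Finset V) : SimpleGraph V :=
  SimpleGraph.fromRel fun u v => f u = f v ∨ v ∈ S (f u)

lemma ncard_edgeSet_fromRel_le {R : V → V → Prop} {d : ℕ} (hR : ∀ u, {v | R u v}.ncard ≤ d) :
    (SimpleGraph.fromRel R).edgeSet.ncard ≤ Fintype.card V * d := by
  have edgeSet_subset : (SimpleGraph.fromRel R).edgeSet ⊆ ⋃ u, (s(u, ·)) '' {v | R u v} := by
    rintro ⟨u, v⟩ ⟨-, h | h⟩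
    · exact Set.mem_iUnion.2 ⟨u, v, h, rfl⟩
    · exact Set.mem_iUnion.2 ⟨v, u, h, Sym2.eq_swap⟩
  calc (SimpleGraph.fromRel R).edgeSet.ncard
      ≤ ∑ u, ((s(u, ·)) '' {v | R u v}).ncard :=
        (Set.ncard_le_ncard edgeSet_subset (Set.toFinite _)).trans
          (Set.ncard_iUnion_le_of_fintype _)
    _ ≤ Fintype.card V * d :=
        Finset.sum_le_card_nsmul _ _ _ fun u _ => (Set.ncard_image_le (Set.toFinite _)).trans (hR u)

lemma ncard_edgeSet_blockGraph_le {f : V → ι} {S : ι → Finset V} {k : ℕ}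
    (hf : ∀ i, {v | f v = i}.ncard ≤ k) (hS : ∀ i, #(S i) ≤ n) :
    (blockGraph f S).edgeSet.ncard ≤ Fintype.card V * (k + n) := by
  refine ncard_edgeSet_fromRel_le fun u => ?_
  calc {v | f u = f v ∨ v ∈ S (f u)}.ncard
      = ({v | f v = f u} ∪ ↑(S (f u))).ncard := by simp only [eq_comm (a := f u)]; rfl
    _ ≤ {v | f v = f u}.ncard + #(S (f u)) := by
        rw [← Set.ncard_coe_finset (S (f u))]
        exact Set.ncard_union_le _ _
    _ ≤ k + n := add_le_add (hf _) (hS _)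

lemma exists_le_blockGraph_of_pathGraph_free {H : SimpleGraph V} (hn : 0 < n)
    (hH : (pathGraph (n + 1)).Free H) {b : ℕ} (hb : Fintype.card V ≤ b * n) :
    ∃ (f : V → Fin b) (S : Fin b → {s : Finset V // #s ≤ n}),
      (∀ i, {v | f v = i}.ncard ≤ n) ∧ H ≤ blockGraph f fun i => S i := by
  obtain ⟨rank, rank_inj, rank_lt, hsep⟩ := exists_rank_of_pathGraph_free hH
  choose S hS mem_S using hsep
  have lt_next (v : V) : rank v < (rank v / n + 1) * n :=
    (Nat.div_lt_iff_lt_mul hn).1 (Nat.lt_succ_self _)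
  have block_lt (v : V) : rank v / n < b :=
    (Nat.div_lt_iff_lt_mul hn).2 ((rank_lt v).trans_le hb)
  have mem_S_block {u v : V} (huv : H.Adj u v) (hlt : rank u / n < rank v / n) :
      v ∈ S ((rank u / n + 1) * n) :=
    mem_S _ u v huv (lt_next u) ((Nat.le_div_iff_mul_le hn).1 hlt)
  refine ⟨fun v => ⟨rank v / n, block_lt v⟩, fun i => ⟨S ((i + 1) * n), hS _⟩,
    fun i => ?_, fun u v huv => ?_⟩
  · calc {v | (⟨rank v / n, block_lt v⟩ : Fin b) = i}.ncard
        ≤ (Set.Ico (i * n) ((i + 1) * n)).ncard := by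
          refine Set.ncard_le_ncard_of_injOn rank ?_ rank_inj.injOn (Set.finite_Ico _ _)
          rintro v rfl
          exact ⟨Nat.div_mul_le_self _ _, lt_next v⟩
      _ = n := by rw [Set.ncard_Ico_nat, add_mul, one_mul, Nat.add_sub_cancel_left]
  · refine (SimpleGraph.fromRel_adj _ u v).2 ⟨huv.ne, ?_⟩
    rcases lt_trichotomy (rank u / n) (rank v / n) with hlt | heq | hgt
    · exact .inl (.inr (mem_S_block huv hlt))
    · exact .inl (.inl (Fin.ext heq))
    · exact .inr (.inr (mem_S_block huv.symm hgt))

lemma exists_pathGraph_free_containers (V : Type*) [Fintype V] {n b : ℕ} (hn : 0 < n)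
    (hb : Fintype.card V ≤ b * n) :
    ∃ 𝓚 : Finset (SimpleGraph V),
      #𝓚 ≤ b ^ Fintype.card V * Fintype.card {s : Finset V // #s ≤ n} ^ b ∧
      (∀ K ∈ 𝓚, K.edgeSet.ncard ≤ Fintype.card V * (2 * n)) ∧
      ∀ H : SimpleGraph V, (pathGraph (n + 1)).Free H → ∃ K ∈ 𝓚, H ≤ K := by
  classical
  let T := (V → Fin b) × (Fin b → {s : Finset V // #s ≤ n})
  let toGraph (t : T) : SimpleGraph V := blockGraph t.1 fun i => t.2 i
  refine ⟨{t : T | ∀ i, {v | t.1 v = i}.ncard ≤ n}.toFinset.image toGraph, ?_, ?_, ?_⟩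
  · calc _ ≤ Fintype.card T := Finset.card_image_le.trans (Finset.card_le_univ _)
      _ = _ := by simp [T]
  · simp only [Finset.forall_mem_image, Set.mem_toFinset, two_mul]
    exact fun t ht => ncard_edgeSet_blockGraph_le ht fun i => (t.2 i).2
  · intro H hH
    obtain ⟨f, S, hf, hHS⟩ := exists_le_blockGraph_of_pathGraph_free hn hH hb
    exact ⟨_, Finset.mem_image_of_mem toGraph (a := (f, S)) (Set.mem_toFinset.2 hf), hHS⟩

end Containers

section BinomialRandomGraph

open MeasureTheory ProbabilityTheory SimpleGraph
open scoped Finset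

variable {V : Type*}

instance [Countable V] : MeasurableSingletonClass (SimpleGraph V) where
  measurableSet_singleton G := by
    have h := measurable_edgeSet (measurableSet_singleton G.edgeSet)
    rwa [← Set.image_singleton, Set.preimage_image_eq _ edgeSet_injective] at h

open Classical in
/-- Expanding the right-hand side gives one term for every set of edges, that is, for every
graph. -/
lemma integral_prod_edgeFinset_binomialRandom [Fintype V] (p : I) (x : Sym2 V → ℝ) :
    ∫ G, ∏ e ∈ G.edgeFinset, x e ∂G(V, p) =
      ∏ e ∈ (⊤ : SimpleGraph V).edgeFinset, (p * x e + (1 - p)) := by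
  have real_singleton (G : SimpleGraph V) : G(V, p).real {G} =
      p ^ #G.edgeFinset * (1 - p) ^ #((⊤ : SimpleGraph V).edgeFinset \ G.edgeFinset) := by
    rw [Finset.card_sdiff_of_subset (edgeFinset_mono le_top),
      card_edgeFinset_top_eq_card_choose_two, ← Set.ncard_coe_finset G.edgeFinset,
      coe_edgeFinset, ← Nat.card_eq_fintype_card, measureReal_def, binomialRandom_singleton]
    simp
  rw [integral_fintype .of_finite, Finset.prod_add]
  refine Finset.sum_bij' (fun G _ => G.edgeFinset) (fun s _ => fromEdgeSet s) ?_ ?_ ?_ ?_ ?_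
  · exact fun G _ => Finset.mem_powerset.2 (edgeFinset_mono le_top)
  · exact fun s _ => Finset.mem_univ _
  · exact fun G _ => by simp
  · intro s hs
    have not_isDiag : ∀ e ∈ s, ¬ e.IsDiag := fun e he =>
      not_isDiag_of_mem_edgeFinset (Finset.mem_powerset.1 hs he)
    ext e
    simpa using not_isDiag e
  · intro G _
    rw [real_singleton, Finset.prod_mul_distrib, Finset.prod_const, Finset.prod_const, smul_eq_mul]
    ring

variable [Finite V]

lemma mgf_ncard_edgeSet_inf (p : I) (K : SimpleGraph V) (t : ℝ) :
    mgf (fun G => ((G ⊓ K).edgeSet.ncard : ℝ)) G(V, p) t =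
      (1 + p * (Real.exp t - 1)) ^ K.edgeSet.ncard := by
  classical
  have := Fintype.ofFinite V
  have exp_eq_prod (G : SimpleGraph V) : Real.exp (t * (G ⊓ K).edgeSet.ncard) =
      ∏ e ∈ G.edgeFinset, if e ∈ K.edgeFinset then Real.exp t else 1 := by
    rw [Finset.prod_ite_mem, Finset.prod_const, ← edgeFinset_inf, ← Set.ncard_coe_finset,
      coe_edgeFinset, mul_comm, Real.exp_nat_mul]
  have factor (e : Sym2 V) : p * (if e ∈ K.edgeFinset then Real.exp t else 1) + (1 - p) =
      if e ∈ K.edgeFinset then 1 + p * (Real.exp t - 1) else (1 : ℝ) := by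
    split_ifs <;> ring
  simp only [mgf, exp_eq_prod, integral_prod_edgeFinset_binomialRandom, factor]
  rw [Finset.prod_ite_mem, Finset.inter_eq_right.2 (edgeFinset_mono le_top), Finset.prod_const,
    ← Set.ncard_coe_finset, coe_edgeFinset]

lemma mgf_ncard_edgeSet_inf_le (p : I) (K : SimpleGraph V) (t : ℝ) :
    mgf (fun G => ((G ⊓ K).edgeSet.ncard : ℝ)) G(V, p) t ≤
      Real.exp (p * (Real.exp t - 1) * K.edgeSet.ncard) := by
  rw [mgf_ncard_edgeSet_inf, mul_comm _ (K.edgeSet.ncard : ℝ), Real.exp_nat_mul]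
  refine pow_le_pow_left₀ ?_ ?_ _
  · nlinarith [Real.exp_pos t, p.2.1, p.2.2]
  · linarith [Real.add_one_le_exp (p * (Real.exp t - 1))]

lemma measureReal_le_ncard_edgeSet_inf_le (p : I) (K : SimpleGraph V) {t : ℝ} (ht : 0 ≤ t)
    (M : ℝ) :
    G(V, p).real {G | M ≤ (G ⊓ K).edgeSet.ncard} ≤
      Real.exp (p * (Real.exp t - 1) * K.edgeSet.ncard - t * M) := by
  calc _ ≤ Real.exp (-t * M) * mgf (fun G => ((G ⊓ K).edgeSet.ncard : ℝ)) G(V, p) t :=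
        measure_ge_le_exp_mul_mgf M ht .of_finite
    _ ≤ Real.exp (-t * M) * Real.exp (p * (Real.exp t - 1) * K.edgeSet.ncard) := by
        gcongr
        exact mgf_ncard_edgeSet_inf_le p K t
    _ = Real.exp (p * (Real.exp t - 1) * K.edgeSet.ncard - t * M) := by
        rw [← Real.exp_add]
        ring_nf

lemma measureReal_ncard_edgeSet_inf_le_half_le (p : I) (K : SimpleGraph V) :
    G(V, p).real {G | ((G ⊓ K).edgeSet.ncard : ℝ) ≤ p * K.edgeSet.ncard / 2} ≤
      Real.exp (-(p * K.edgeSet.ncard / 8)) := by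
  have hmean : 0 ≤ p * (K.edgeSet.ncard : ℝ) := mul_nonneg p.2.1 (Nat.cast_nonneg _)
  have exp_neg_log_two : Real.exp (-Real.log 2) = 1 / 2 := by
    rw [Real.exp_neg, Real.exp_log two_pos, one_div]
  have hchernoff := measure_le_le_exp_mul_mgf (μ := G(V, p))
    (X := fun G => ((G ⊓ K).edgeSet.ncard : ℝ)) (t := -Real.log 2) (p * K.edgeSet.ncard / 2)
    (by linarith [Real.log_two_gt_d9]) .of_finite
  have hmgf := mgf_ncard_edgeSet_inf_le p K (-Real.log 2)
  rw [exp_neg_log_two] at hmgf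
  calc _ ≤ Real.exp (Real.log 2 * (p * K.edgeSet.ncard / 2)) *
        Real.exp (p * (1 / 2 - 1) * K.edgeSet.ncard) := by
        rw [neg_neg] at hchernoff
        exact hchernoff.trans (by gcongr)
    _ ≤ Real.exp (-(p * K.edgeSet.ncard / 8)) := by
        rw [← Real.exp_add, Real.exp_le_exp]
        nlinarith [Real.log_two_lt_d9]

lemma measureReal_ncard_edgeSet_le_half_le (V : Type*) [Fintype V] (p : I) :
    G(V, p).real {G | (G.edgeSet.ncard : ℝ) ≤ p * (Fintype.card V).choose 2 / 2} ≤
      Real.exp (-(p * (Fintype.card V).choose 2 / 8)) := by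
  classical
  have card_top : (⊤ : SimpleGraph V).edgeSet.ncard = (Fintype.card V).choose 2 := by
    rw [← card_edgeFinset_top_eq_card_choose_two (V := V), ← Set.ncard_coe_finset, coe_edgeFinset]
  simpa only [inf_top_eq, card_top] using
    measureReal_ncard_edgeSet_inf_le_half_le p (⊤ : SimpleGraph V)

end BinomialRandomGraph

section ColourBound

open MeasureTheory SimpleGraph
open scoped Finset

variable {V : Type*} [Fintype V] {n : ℕ} {r ω : ℝ}

/-- Weigh every set `s` by `x ^ #s`, where `x = n / N`: all sets together have weight
`(1 + x) ^ N ≤ exp n`, and each set of at most `n` elements has weight at least `x ^ n`. -/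
lemma card_finset_card_le_le (hn : 0 < n) (hnV : n ≤ Fintype.card V) :
    (Fintype.card {s : Finset V // #s ≤ n} : ℝ) ≤ (Real.exp 1 * Fintype.card V / n) ^ n := by
  classical
  have : (0 : ℝ) < n := by exact_mod_cast hn
  have hV : (0 : ℝ) < Fintype.card V := by exact_mod_cast hn.trans_le hnV
  set x : ℝ := n / Fintype.card V with hx
  have hx0 : 0 < x := by positivity
  have hx1 : x ≤ 1 := (div_le_one hV).2 (by exact_mod_cast hnV)
  have hbase : Real.exp 1 * Fintype.card V / n = Real.exp 1 / x := by rw [hx]; field_simp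
  rw [hbase, div_pow, le_div_iff₀ (by positivity)]
  calc (Fintype.card {s : Finset V // #s ≤ n} : ℝ) * x ^ n = ∑ s : Finset V with #s ≤ n, x ^ n := by
        rw [Finset.sum_const, nsmul_eq_mul, Fintype.card_subtype]
    _ ≤ ∑ s : Finset V with #s ≤ n, x ^ #s :=
        Finset.sum_le_sum fun s hs =>
          pow_le_pow_of_le_one hx0.le hx1 (Finset.mem_filter.1 hs).2
    _ ≤ ∑ s : Finset V, x ^ #s :=
        Finset.sum_le_sum_of_subset_of_nonneg (Finset.filter_subset _ _) fun s _ _ => by positivity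
    _ = (x + 1) ^ Fintype.card V := by
        simpa using (Finset.prod_add (fun _ : V => x) (fun _ => 1) Finset.univ).symm
    _ ≤ Real.exp x ^ Fintype.card V := by
        gcongr
        exact Real.add_one_le_exp x
    _ = Real.exp 1 ^ n := by
        rw [← Real.exp_nat_mul, ← Real.exp_nat_mul, hx, mul_div_cancel₀ _ hV.ne', mul_one]

lemma five_mul_log_le (hω : 34 ≤ ω) : 5 * Real.log ω ≤ ω := by
  have htangent : Real.log (ω / 2 ^ 3) ≤ ω / 2 ^ 3 - 1 :=
    Real.log_le_sub_one_of_pos (by linarith)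
  rw [Real.log_div (by linarith) (by norm_num), Real.log_pow] at htangent
  push_cast at htangent
  linarith [Real.log_two_lt_d9]

lemma four_le_log (hr : 120 ≤ r) : 4 ≤ Real.log r := by
  rw [Real.le_log_iff_exp_le (by linarith)]
  calc Real.exp 4 = Real.exp 1 ^ 4 := by rw [← Real.exp_nat_mul]; norm_num
    _ ≤ 3 ^ 4 := by gcongr; linarith [Real.exp_one_lt_d9]
    _ ≤ r := by linarith

lemma natCeil_pow_le (hr : 0 < r) (N : ℕ) :
    (⌈r⌉₊ : ℝ) ^ N ≤ Real.exp (N * Real.log r + N / r) := by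
  have hceil : (⌈r⌉₊ : ℝ) ≤ Real.exp (Real.log r + r⁻¹) := by
    calc (⌈r⌉₊ : ℝ) ≤ r + 1 := (Nat.ceil_lt_add_one hr.le).le
      _ = r * (r⁻¹ + 1) := by field_simp; ring
      _ ≤ r * Real.exp r⁻¹ := by gcongr; exact Real.add_one_le_exp _
      _ = Real.exp (Real.log r + r⁻¹) := by rw [Real.exp_add, Real.exp_log hr]
  calc (⌈r⌉₊ : ℝ) ^ N ≤ Real.exp (Real.log r + r⁻¹) ^ N := by gcongr
    _ = Real.exp (N * Real.log r + N / r) := by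
        rw [← Real.exp_nat_mul, mul_add, div_eq_mul_inv]

lemma natCeil_pow_mul_card_finset_pow_le (hn : 0 < n) (hV : (Fintype.card V : ℝ) = r * n)
    (hr : 120 ≤ r) :
    (⌈r⌉₊ : ℝ) ^ Fintype.card V * (Fintype.card {s : Finset V // #s ≤ n} : ℝ) ^ ⌈r⌉₊ ≤
      Real.exp (23 / 10 * (Fintype.card V * Real.log r)) := by
  have hn' : (0 : ℝ) < n := by exact_mod_cast hn
  have hlog := four_le_log hr
  have hnV : 120 * (n : ℝ) ≤ Fintype.card V := by rw [hV]; gcongr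
  have hblocks : (⌈r⌉₊ : ℝ) ^ Fintype.card V ≤ Real.exp (Fintype.card V * Real.log r + n) := by
    have hdiv : (Fintype.card V : ℝ) / r = n := by rw [hV]; field_simp
    simpa only [hdiv] using natCeil_pow_le (r := r) (by linarith) (Fintype.card V)
  have hcard : (Fintype.card {s : Finset V // #s ≤ n} : ℝ) ≤ Real.exp (n * (1 + Real.log r)) := by
    have hdiv : Real.exp 1 * Fintype.card V / n = Real.exp (1 + Real.log r) := by
      rw [Real.exp_add, Real.exp_log (by linarith), hV]
      field_simp
    rw [Real.exp_nat_mul, ← hdiv]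
    exact card_finset_card_le_le hn (by exact_mod_cast (by linarith : (n : ℝ) ≤ Fintype.card V))
  have hceil : (⌈r⌉₊ : ℝ) * n ≤ Fintype.card V + n := by
    rw [hV, ← add_one_mul]
    gcongr
    exact (Nat.ceil_lt_add_one (by linarith)).le
  have hattached : (Fintype.card {s : Finset V // #s ≤ n} : ℝ) ^ ⌈r⌉₊ ≤
      Real.exp ((Fintype.card V + n) * (1 + Real.log r)) := by
    calc _ ≤ Real.exp (n * (1 + Real.log r)) ^ ⌈r⌉₊ := by gcongr
      _ = Real.exp (⌈r⌉₊ * n * (1 + Real.log r)) := by rw [← Real.exp_nat_mul, mul_assoc]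
      _ ≤ _ := by gcongr
  refine (mul_le_mul hblocks hattached (by positivity) (by positivity)).trans ?_
  rw [← Real.exp_add, Real.exp_le_exp]
  nlinarith [mul_le_mul_of_nonneg_right hnV (by linarith : 0 ≤ Real.log r - 4)]

/-- Chernoff's bound with `exp t = √ω`: the mean `2 * p * n * N` is so small that, even after
multiplication by `√ω ≥ 5`, it is at most `2 / 5 * N * log r`, while `t * M` is
`11 / 4 * N * log r`. -/
lemma measureReal_le_ncard_edgeSet_inf_container_le (p : I) (hω : 34 ≤ ω)
    (hpω : (n : ℝ) * p * ω = Real.log r) {K : SimpleGraph V}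
    (hK : K.edgeSet.ncard ≤ Fintype.card V * (2 * n)) :
    G(V, p).real {G | 11 / 2 * (Fintype.card V * Real.log r / Real.log ω) ≤
        (G ⊓ K).edgeSet.ncard} ≤ Real.exp (-(47 / 20) * (Fintype.card V * Real.log r)) := by
  have hp0 : (0 : ℝ) ≤ p := p.2.1
  have hω0 : 0 < ω := by linarith
  have hsqrt : 5 ≤ √ω := Real.le_sqrt_of_sq_le (by linarith)
  have hlogω : 0 < Real.log ω := Real.log_pos (by linarith)
  have hlog_sqrt : Real.log √ω = Real.log ω / 2 := Real.log_sqrt hω0.le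
  have hmean : p * √ω * (n * 5) ≤ Real.log r := by
    calc p * √ω * (n * 5) ≤ p * √ω * (n * √ω) := by gcongr
      _ = n * p * (√ω * √ω) := by ring
      _ = Real.log r := by rw [Real.mul_self_sqrt hω0.le, hpω]
  refine (measureReal_le_ncard_edgeSet_inf_le p K (t := Real.log √ω) (by linarith) _).trans
    (Real.exp_le_exp.2 ?_)
  have hexponent : Real.log √ω * (11 / 2 * (Fintype.card V * Real.log r / Real.log ω)) =
      11 / 4 * (Fintype.card V * Real.log r) := by
    rw [hlog_sqrt]
    field_simp
    ring
  have hexpected : p * (√ω - 1) * K.edgeSet.ncard ≤ 2 / 5 * (Fintype.card V * Real.log r) := by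
    calc p * (√ω - 1) * K.edgeSet.ncard ≤ p * √ω * (Fintype.card V * (2 * n)) := by
          gcongr
          · linarith
          · exact_mod_cast hK
      _ = 2 / 5 * (Fintype.card V * (p * √ω * (n * 5))) := by ring
      _ ≤ _ := by gcongr
  rw [hexponent, Real.exp_log (by positivity)]
  linarith

lemma measureReal_exists_pathGraph_free_le (hn : 0 < n) (p : I)
    (hV : (Fintype.card V : ℝ) = r * n) (hr : 120 ≤ r) (hω : 34 ≤ ω)
    (hpω : (n : ℝ) * p * ω = Real.log r) :
    G(V, p).real {G | ∃ H ≤ G, (pathGraph (n + 1)).Free H ∧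
        11 / 2 * (Fintype.card V * Real.log r / Real.log ω) < H.edgeSet.ncard} ≤
      Real.exp (-(Fintype.card V / 5)) := by
  set M : ℝ := 11 / 2 * (Fintype.card V * Real.log r / Real.log ω)
  have hblocks : Fintype.card V ≤ ⌈r⌉₊ * n := by
    have : (Fintype.card V : ℝ) ≤ ⌈r⌉₊ * n := by rw [hV]; gcongr; exact Nat.le_ceil r
    exact_mod_cast this
  obtain ⟨𝓚, hcard, hedges, hcontains⟩ := exists_pathGraph_free_containers V hn hblocks
  have hsubset : {G : SimpleGraph V | ∃ H ≤ G, (pathGraph (n + 1)).Free H ∧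
      M < H.edgeSet.ncard} ⊆ ⋃ K ∈ 𝓚, {G | M ≤ (G ⊓ K).edgeSet.ncard} := by
    rintro G ⟨H, hHG, hH, hMH⟩
    obtain ⟨K, hK, hHK⟩ := hcontains H hH
    refine Set.mem_biUnion hK (hMH.le.trans ?_)
    exact_mod_cast Set.ncard_le_ncard (edgeSet_mono (le_inf hHG hHK)) (Set.toFinite _)
  calc _ ≤ ∑ K ∈ 𝓚, G(V, p).real {G | M ≤ (G ⊓ K).edgeSet.ncard} :=
        (measureReal_mono hsubset (measure_ne_top _ _)).trans (measureReal_biUnion_finset_le _ _)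
    _ ≤ #𝓚 * Real.exp (-(47 / 20) * (Fintype.card V * Real.log r)) := by
        rw [← nsmul_eq_mul]
        exact Finset.sum_le_card_nsmul _ _ _ fun K hK =>
          measureReal_le_ncard_edgeSet_inf_container_le p hω hpω (hedges K hK)
    _ ≤ Real.exp (23 / 10 * (Fintype.card V * Real.log r)) *
          Real.exp (-(47 / 20) * (Fintype.card V * Real.log r)) := by
        gcongr
        refine le_trans ?_ (natCeil_pow_mul_card_finset_pow_le hn hV hr)
        exact_mod_cast hcard
    _ ≤ Real.exp (-(Fintype.card V / 5)) := by
        rw [← Real.exp_add, Real.exp_le_exp]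
        have := mul_le_mul_of_nonneg_left (four_le_log hr) (Nat.cast_nonneg (Fintype.card V))
        linarith

/-- Below `r = 120` the claimed number of colours is less than one, so it only fails when there
are no edges. -/
lemma measureReal_minColors_lt_le_of_lt (hn : 2 ≤ n) (p : I) (hr : r < 120) (hω : 34 ≤ ω) :
    G(V, p).real {G | (G.minColors (pathGraph (n + 1)) : ℝ) < Real.log ω / (24 * ω) * r} ≤
      Real.exp (-(p * (Fintype.card V).choose 2 / 8)) := by
  have hlogω : 0 < Real.log ω := Real.log_pos (by linarith)
  have bound_lt_one : Real.log ω / (24 * ω) * r < 1 := by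
    rw [div_mul_eq_mul_div, div_lt_one (by linarith)]
    nlinarith [five_mul_log_le hω]
  refine (measureReal_mono fun G hG => ?_).trans (measureReal_ncard_edgeSet_le_half_le V p)
  have minColors_eq_zero : G.minColors (pathGraph (n + 1)) = 0 :=
    Nat.lt_one_iff.1 (by exact_mod_cast lt_trans hG bound_lt_one)
  have edgeSet_eq_empty :=
    edgeSet_eq_empty_of_minColors_eq_zero (nontrivial_edgeSet_pathGraph hn) minColors_eq_zero
  have hp0 : (0 : ℝ) ≤ p := p.2.1
  rw [Set.mem_ofPred_eq, edgeSet_eq_empty, Set.ncard_empty, Nat.cast_zero]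
  positivity

lemma measureReal_minColors_lt_le_of_le (hn : 2 ≤ n) (p : I)
    (hV : (Fintype.card V : ℝ) = r * n) (hr : 120 ≤ r) (hω : 34 ≤ ω)
    (hpω : (n : ℝ) * p * ω = Real.log r) :
    G(V, p).real {G | (G.minColors (pathGraph (n + 1)) : ℝ) < Real.log ω / (24 * ω) * r} ≤
      Real.exp (-(p * (Fintype.card V).choose 2 / 8)) + Real.exp (-(Fintype.card V / 5)) := by
  refine (measureReal_mono fun G hG => ?_).trans ((measureReal_union_le _ _).trans
    (add_le_add (measureReal_ncard_edgeSet_le_half_le V p)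
      (measureReal_exists_pathGraph_free_le (by omega) p hV hr hω hpω)))
  by_contra hgood
  simp only [Set.mem_union, Set.mem_ofPred_eq, not_or, not_le, not_exists, not_and, not_lt]
    at hgood hG
  obtain ⟨many_edges, few_edges⟩ := hgood
  set M : ℝ := 11 / 2 * (Fintype.card V * Real.log r / Real.log ω) with hM
  have hp0 : (0 : ℝ) ≤ p := p.2.1
  have hn' : (2 : ℝ) ≤ n := by exact_mod_cast hn
  have hVlarge : 12 ≤ (Fintype.card V : ℝ) := by rw [hV]; nlinarith
  have hlogω : 0 < Real.log ω := Real.log_pos (by linarith)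
  have hlogr : 0 < Real.log r := Real.log_pos (by linarith)
  have edges_le := ncard_edgeSet_le_minColors_mul (nontrivial_edgeSet_pathGraph hn) few_edges
  have hcolours : Real.log ω / (24 * ω) * r * M = 11 / 48 * (p * (Fintype.card V : ℝ) ^ 2) := by
    rw [hM, ← hpω, hV]
    field_simp
    ring
  have hedges : 11 / 48 * (p * (Fintype.card V : ℝ) ^ 2) ≤
      p * (Fintype.card V).choose 2 / 2 := by
    rw [Nat.cast_choose_two]
    have : 0 ≤ p * (Fintype.card V : ℝ) * (Fintype.card V - 12) :=
      mul_nonneg (by positivity) (by linarith)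
    linarith
  have : G.minColors (pathGraph (n + 1)) * M ≤ Real.log ω / (24 * ω) * r * M := by gcongr
  linarith

lemma measureReal_minColors_lt_le (hn : 2 ≤ n) (p : I) (hV : (Fintype.card V : ℝ) = r * n)
    (hω : 34 ≤ ω) (hpω : (n : ℝ) * p * ω = Real.log r) :
    G(V, p).real {G | (G.minColors (pathGraph (n + 1)) : ℝ) < Real.log ω / (24 * ω) * r} ≤
      Real.exp (-(p * (Fintype.card V).choose 2 / 8)) + Real.exp (-(Fintype.card V / 5)) := by
  rcases lt_or_ge r 120 with hr | hr
  · exact (measureReal_minColors_lt_le_of_lt hn p hr hω).trans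
      (le_add_of_nonneg_right (Real.exp_nonneg _))
  · exact measureReal_minColors_lt_le_of_le hn p hV hr hω hpω

end ColourBound

section Limits

open MeasureTheory

variable {ι : Type*} {l : Filter ι}

lemma tendsto_measure_one_of_measureReal_compl_le {Ω : ι → Type*} [∀ i, MeasurableSpace (Ω i)]
    {μ : ∀ i, Measure (Ω i)} [∀ i, IsProbabilityMeasure (μ i)] {s : ∀ i, Set (Ω i)}
    (hs : ∀ i, MeasurableSet (s i)) {ε : ι → ℝ} (hε : Tendsto ε l (𝓝 0))
    (hle : ∀ᶠ i in l, (μ i).real (s i)ᶜ ≤ ε i) : Tendsto (fun i => μ i (s i)) l (𝓝 1) := by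
  have hcompl : Tendsto (fun i => (μ i).real (s i)ᶜ) l (𝓝 0) :=
    squeeze_zero' (.of_forall fun _ => measureReal_nonneg) hle hε
  rw [← ENNReal.tendsto_toReal_iff (fun i => measure_ne_top _ _) ENNReal.one_ne_top,
    ENNReal.toReal_one]
  simpa [probReal_compl_eq_one_sub (hs _), measureReal_def] using hcompl.const_sub 1

lemma tendsto_mul_choose_two_atTop {p : ι → ℝ} {N : ι → ℕ} (hp : ∀ i, 0 ≤ p i)
    (hN : ∀ᶠ i in l, 2 ≤ N i) (h : Tendsto (fun i => p i * (N i : ℝ) ^ 2) l atTop) :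
    Tendsto (fun i => p i * (N i).choose 2) l atTop := by
  refine tendsto_atTop_mono' l (hN.mono fun i hi => ?_)
    (h.atTop_div_const (by norm_num : (0 : ℝ) < 4))
  have hi' : (2 : ℝ) ≤ N i := by exact_mod_cast hi
  have : 0 ≤ p i * N i * (N i - 2) := mul_nonneg (mul_nonneg (hp i) (by linarith)) (by linarith)
  beta_reduce
  rw [Nat.cast_choose_two]
  linarith

lemma tendsto_exp_neg_div_const {f : ι → ℝ} (hf : Tendsto f l atTop) {c : ℝ} (hc : 0 < c) :
    Tendsto (fun i => Real.exp (-(f i / c))) l (𝓝 0) :=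
  Real.tendsto_exp_neg_atTop_nhds_zero.comp (hf.atTop_div_const hc)

end Limits

theorem theorem5p5 (N : ℕ → ℕ) (p : ℕ → I)
    (hN : ∀ᶠ n : ℕ in atTop, n < N n)
    (hp : ∀ᶠ n : ℕ in atTop, (p n : ℝ) ≤ Real.log ((N n : ℝ) / n) / (34 * n))
    (hp_low : Tendsto (fun n : ℕ => (p n : ℝ) * (N n : ℝ) ^ 2) atTop atTop) :
    Tendsto
      (fun n : ℕ =>
        SimpleGraph.binomialRandom (Fin (N n)) (p n)
          {G : SimpleGraph (Fin (N n)) |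
            let r : ℝ := (N n : ℝ) / n
            let ω : ℝ := Real.log r / (n * p n)
            Real.log ω / (24 * ω) * r ≤ (G.minColors (SimpleGraph.pathGraph (n + 1)) : ℝ)})
      atTop (𝓝 1) := by
  have hN_atTop : Tendsto (fun n => (N n : ℝ)) atTop atTop :=
    tendsto_atTop_mono' atTop (hN.mono fun n hn => Nat.cast_le.2 hn.le)
      tendsto_natCast_atTop_atTop
  have hN_two : ∀ᶠ n in atTop, 2 ≤ N n := by
    filter_upwards [hN, eventually_ge_atTop 2] with n hn hn2 using hn2.trans hn.le
  have hε : Tendsto (fun n => Real.exp (-(p n * (N n).choose 2 / 8)) + Real.exp (-(N n / 5)))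
      atTop (𝓝 0) := by
    simpa only [add_zero] using (tendsto_exp_neg_div_const
      (tendsto_mul_choose_two_atTop (fun n => (p n).2.1) hN_two hp_low) (by norm_num)).add
      (tendsto_exp_neg_div_const hN_atTop (by norm_num))
  refine tendsto_measure_one_of_measureReal_compl_le (fun n => (Set.toFinite _).measurableSet) hε ?_
  filter_upwards [hp, hp_low.eventually_gt_atTop 0, eventually_ge_atTop 2] with n hpn hpos hn
  have hp0 : 0 < (p n : ℝ) := pos_of_mul_pos_left hpos (by positivity)
  have hω : 34 ≤ Real.log (N n / n) / (n * p n) := by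
    rw [le_div_iff₀ (by positivity)] at hpn ⊢
    linarith
  have hpω : (n : ℝ) * p n * (Real.log (N n / n) / (n * p n)) = Real.log (N n / n) :=
    mul_div_cancel₀ _ (by positivity)
  simpa only [Set.compl_ofPred, not_le, Fintype.card_fin] using
    measureReal_minColors_lt_le (V := Fin (N n)) hn (p n) (r := N n / n)
      (by rw [Fintype.card_fin]; field_simp) hω hpω
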